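/- For real $\nu$ and $x>0$ let $I_\nu(x)=\sum_{n\ge 0}\frac{(x/2)^{2n+\nu}}{n!\,\Gamma(n+\nu+1)}$ be the modified Bessel function of the first kind (with $1/\Gamma=0$ at the nonpositive integers), and put $$\Phi_\nu(x)=e^{-x}x^{-\nu}\left[I_\nu(x)+I_{\nu+1}(x)\right]\ (\nu\in\mathbb R),\qquad \Psi_\nu(x)=\sqrt{\pi}\,2^{\nu}\,\Gamma\left(\nu+\tfrac12\right)\Phi_\nu(x)\ \left(\nu>-\tfrac12\right).$$ Let $x>0$. Then: (i) the function $\nu\mapsto\Phi_\nu(x)$ is log-concave on $(-1,\infty)$, that is, it is positive there and its logarithm is concave; (ii) the function $\nu\mapsto\Psi_\nu(x)$ is completely monotonic on $(-\tfrac12,\infty)$, that is, it has derivatives of all orders in $\nu$ and $(-1)^m\frac{\partial^m}{\partial\nu^m}\Psi_\nu(x)\ge 0$ for all $m\in\{0,1,2,\dots\}$ and $\nu>-\tfrac12$; it is also log-convex on $(-\tfrac12,\infty)$, that is, it is positive there and its logarithm is convex; (iii) for all $\nu>\tfrac12$, $$0<\left[\Phi_\nu(x)\right]^2-\Phi_{\nu-1}(x)\Phi_{\nu+1}(x)\le\frac{1}{\nu+\frac12}\left[\Phi_\nu(x)\right]^2;$$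 (iv) the left-hand inequality $0<\left[\Phi_\nu(x)\right]^2-\Phi_{\nu-1}(x)\Phi_{\nu+1}(x)$ in (iii) holds for all $\nu>-1$. -/

import Mathlib

open Set Filter Topology

noncomputable section

/-- The modified Bessel function of the first kind of real order `ν` at a real argument `x > 0`,
`I_ν(x) = ∑ (x/2)^(2n+ν) / (n! Γ(n+ν+1))`. At the poles of `Γ` Mathlib has `Real.Gamma = 0`, so that
the quotient is `0` there, in agreement with the usual convention that `1/Γ` vanishes at the
nonpositive integers. -/
def besselI (ν x : ℝ) : ℝ :=
  ∑' n : ℕ, (x / 2) ^ (2 * (n : ℝ) + ν) / ((n.factorial : ℝ) * Real.Gamma ((n : ℝ) + ν + 1))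

/-- The series defining `besselI` converges for every real order and every positive argument. -/
theorem summable_besselI (ν : ℝ) {x : ℝ} (hx : 0 < x) :
    Summable fun n : ℕ =>
      (x / 2) ^ (2 * (n : ℝ) + ν) / ((n.factorial : ℝ) * Real.Gamma ((n : ℝ) + ν + 1)) := by
  have hx2 : 0 < x / 2 := by positivity
  have hev : ∀ᶠ n : ℕ in atTop, 0 < (n : ℝ) + ν + 1 := by
    filter_upwards [(tendsto_natCast_atTop_atTop (R := ℝ)).eventually_gt_atTop (-ν - 1)] with n hn
    linarith
  refine summable_of_ratio_test_tendsto_lt_one (l := 0) one_pos ?_ ?_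
  · filter_upwards [hev] with n hn
    have h1 := Real.Gamma_pos_of_pos hn
    have h2 : (0 : ℝ) < n.factorial := by exact_mod_cast n.factorial_pos
    positivity
  · have hlim : Tendsto (fun n : ℕ => (x / 2) ^ 2 / (((n : ℝ) + 1) * ((n : ℝ) + ν + 1)))
        atTop (𝓝 0) := by
      refine Tendsto.const_div_atTop ?_ _
      refine Tendsto.atTop_mul_atTop₀ ?_ ?_
      · exact tendsto_atTop_add_const_right _ _ tendsto_natCast_atTop_atTop
      · exact tendsto_atTop_add_const_right _ _
          (tendsto_atTop_add_const_right _ _ tendsto_natCast_atTop_atTop)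
    refine hlim.congr' ?_
    filter_upwards [hev] with n hn
    have h1 := Real.Gamma_pos_of_pos hn
    have h2 : (0 : ℝ) < n.factorial := by exact_mod_cast n.factorial_pos
    have h3 : Real.Gamma (((n + 1 : ℕ) : ℝ) + ν + 1)
        = ((n : ℝ) + ν + 1) * Real.Gamma ((n : ℝ) + ν + 1) := by
      rw [← Real.Gamma_add_one hn.ne']
      congr 1
      push_cast
      ring
    have h4 : (x / 2) ^ (2 * ((n + 1 : ℕ) : ℝ) + ν)
        = (x / 2) ^ (2 * (n : ℝ) + ν) * (x / 2) ^ 2 := by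
      rw [← Real.rpow_add_natCast hx2.ne']
      congr 1
      push_cast
      ring
    have h5 : 0 < (x / 2) ^ (2 * (n : ℝ) + ν) := Real.rpow_pos_of_pos hx2 _
    rw [h3, h4, Nat.factorial_succ, Nat.cast_mul, Nat.cast_succ, Real.norm_of_nonneg (by positivity),
      Real.norm_of_nonneg (by positivity)]
    field_simp

/-- `Φ_ν(x) = e^{-x} x^{-ν} (I_ν(x) + I_{ν+1}(x))`. -/
def besselPhi (ν x : ℝ) : ℝ :=
  Real.exp (-x) * x ^ (-ν) * (besselI ν x + besselI (ν + 1) x)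

/-- `Ψ_ν(x) = √π 2^ν Γ(ν+1/2) Φ_ν(x)`. -/
def besselPsi (ν x : ℝ) : ℝ :=
  Real.sqrt Real.pi * (2 : ℝ) ^ ν * Real.Gamma (ν + 1 / 2) * besselPhi ν x

/-- `f` is positive on `s` and `log f` is concave on `s`. -/
def LogConcaveOn (s : Set ℝ) (f : ℝ → ℝ) : Prop :=
  (∀ t ∈ s, 0 < f t) ∧ ConcaveOn ℝ s fun t => Real.log (f t)

/-- `f` is positive on `s` and `log f` is convex on `s`. -/
def LogConvexOn (s : Set ℝ) (f : ℝ → ℝ) : Prop :=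
  (∀ t ∈ s, 0 < f t) ∧ ConvexOn ℝ s fun t => Real.log (f t)

/-- `f` is completely monotonic on the open half-line `(a, ∞)`: it has derivatives of all orders
there and `(-1)^m f^{(m)} ≥ 0` for every `m ≥ 0`. -/
def CompletelyMonotonicOnIoi (a : ℝ) (f : ℝ → ℝ) : Prop :=
  ContDiffOn ℝ (⊤ : ℕ∞) f (Ioi a) ∧
    ∀ m : ℕ, ∀ t ∈ Ioi a, 0 ≤ (-1 : ℝ) ^ m * iteratedDeriv m f t

end

/-!
Write `y = x/2` and `C_ν(z) = ∑ zⁿ / (n! Γ(n+ν+1))`, the entire function behind `I_ν`. Then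
`Φ_ν(x) = e^{-x} 2^{-ν} F_ν` with `F_ν = C_ν(y²) + y C_{ν+1}(y²)`, and the exponential factors are
log-linear in `ν`, so everything is a statement about `F`.

Log-concavity and the Turán inequality come from a power series of the product `F_μ F_ν`. By the
Chu–Vandermonde identity (`hasSum_besselClifford_mul`) the `k`-th coefficient of `C_μ C_ν` is a
function of `μ + ν`, nonnegative for `μ + ν > -2`, times `1 / (Γ(μ+k+1) Γ(ν+k+1))`. In
`C_{μ+1} C_ν + C_μ C_{ν+1}` neither term has this symmetric form, but their sum does
(`hasSum_besselClifford_mul_add_mul`), since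
`1/(Γ(a+1) Γ(b)) + 1/(Γ(a) Γ(b+1)) = (a+b) / (Γ(a+1) Γ(b+1))`. Hence `F_μ F_ν` and `F_s²`, with
`s = (μ+ν)/2`, compare coefficientwise as the products of reciprocal Gamma values do. For
`μ, ν > -1` log-convexity of `Γ` gives `F_μ F_ν ≤ F_s²`, which with continuity in `ν` is
log-concavity. For the orders `ν ± 1` the functional equation of `1/Γ` gives the strict inequality
down to `ν > -1`, although `ν - 1` may then lie below `-1`.

For complete monotonicity, the Beta integral turns `Γ(ν+1/2) F_ν` into `∫₀¹ (1-s)^{ν-1/2} g(s) ds`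
with `g ≥ 0`. So `ν ↦ Ψ_ν(x)` is the moment generating function of the nonpositive function
`log (1-s)` under a measure on `(0, 1)` (`besselPsi_eq_mgf`). Its derivatives have the signs of the
moments, and its logarithm is a convex cumulant generating function. Log-convexity of `Ψ` at
`ν - 1`, `ν`, `ν + 1`, with the Gamma factors removed, is the right-hand inequality for `Φ`.
-/

/-! ### Reciprocal Gamma function and falling factorials -/

/-- With `1/Γ = 0` at the poles, the functional equation of `1/Γ` holds at every real number. -/
theorem inv_Gamma_eq_mul_inv_Gamma_add_one (a : ℝ) :
    (Real.Gamma a)⁻¹ = a * (Real.Gamma (a + 1))⁻¹ := by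
  rcases eq_or_ne a 0 with rfl | ha
  · simp
  · rw [Real.Gamma_add_one ha, mul_inv, mul_inv_cancel_left₀ ha]

/-- The iterated functional equation of `1/Γ`, again without exceptions at the poles. -/
theorem inv_Gamma_sub_nat_eq (a : ℝ) (j : ℕ) :
    (Real.Gamma (a + 1 - j))⁻¹ = (descPochhammer ℝ j).eval a * (Real.Gamma (a + 1))⁻¹ := by
  induction j with
  | zero => simp
  | succ j ih =>
    rw [descPochhammer_succ_eval, inv_Gamma_eq_mul_inv_Gamma_add_one,
      show a + 1 - ((j + 1 : ℕ) : ℝ) + 1 = a + 1 - j by push_cast; ring, ih]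
    push_cast
    ring

/-- The Chu–Vandermonde identity for falling factorials of real numbers. -/
theorem descPochhammer_eval_add (k : ℕ) (r s : ℝ) :
    (descPochhammer ℝ k).eval (r + s) = ∑ ij ∈ Finset.HasAntidiagonal.antidiagonal k,
      (k.choose ij.1 : ℝ) * ((descPochhammer ℝ ij.1).eval r * (descPochhammer ℝ ij.2).eval s) := by
  have h : ∀ (n : ℕ) (t : ℝ), (descPochhammer ℝ n).eval t = (descPochhammer ℤ n).smeval t := by
    intro n t
    rw [← Polynomial.aeval_eq_smeval, ← descPochhammer_map (Int.castRingHom ℝ), Polynomial.aeval_def,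
      Polynomial.eval_map]
    rfl
  simp only [h]
  exact Ring.descPochhammer_smeval_add k (Commute.all r s)

/-! ### The Bessel–Clifford function -/

/-- The Bessel–Clifford function `C_ν(z) = ∑ zⁿ / (n! Γ(n+ν+1))`, so that
`I_ν(x) = (x/2)^ν C_ν((x/2)²)`. The convention `1/Γ = 0` at the poles is that of `besselI`. -/
noncomputable def besselClifford (ν z : ℝ) : ℝ :=
  ∑' n : ℕ, z ^ n / ((n.factorial : ℝ) * Real.Gamma ((n : ℝ) + ν + 1))

theorem half_rpow_two_mul_nat_add {x : ℝ} (hx : 0 < x) (n : ℕ) (ν : ℝ) :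
    (x / 2) ^ (2 * (n : ℝ) + ν) = (x / 2) ^ ν * ((x / 2) ^ 2) ^ n := by
  have h2 : 0 < x / 2 := by positivity
  rw [Real.rpow_add h2, mul_comm, ← pow_mul, ← Real.rpow_natCast]
  push_cast
  rfl

theorem besselI_eq {x : ℝ} (hx : 0 < x) (ν : ℝ) :
    besselI ν x = (x / 2) ^ ν * besselClifford ν ((x / 2) ^ 2) := by
  rw [besselI, besselClifford, ← tsum_mul_left]
  refine tsum_congr fun n => ?_
  rw [half_rpow_two_mul_nat_add hx, mul_div_assoc]

theorem summable_besselClifford (ν : ℝ) {z : ℝ} (hz : 0 < z) :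
    Summable fun n : ℕ => z ^ n / ((n.factorial : ℝ) * Real.Gamma ((n : ℝ) + ν + 1)) := by
  obtain ⟨x, hx, rfl⟩ : ∃ x : ℝ, 0 < x ∧ (x / 2) ^ 2 = z :=
    ⟨2 * √z, by positivity, by rw [mul_div_cancel_left₀ _ two_ne_zero, Real.sq_sqrt hz.le]⟩
  refine ((summable_besselI ν hx).mul_left ((x / 2) ^ ν)⁻¹).congr fun n => ?_
  have : (x / 2) ^ ν ≠ 0 := (Real.rpow_pos_of_pos (by positivity) _).ne'
  rw [half_rpow_two_mul_nat_add hx, mul_div_assoc, inv_mul_cancel_left₀ this]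

theorem besselClifford_pos {ν z : ℝ} (hν : -1 < ν) (hz : 0 < z) : 0 < besselClifford ν z := by
  have hpos : ∀ n : ℕ, 0 < z ^ n / ((n.factorial : ℝ) * Real.Gamma ((n : ℝ) + ν + 1)) := by
    intro n
    have hn : (0 : ℝ) ≤ n := n.cast_nonneg
    have := Real.Gamma_pos_of_pos (show 0 < (n : ℝ) + ν + 1 by linarith)
    positivity
  exact (summable_besselClifford ν hz).tsum_pos (fun n => (hpos n).le) 0 (hpos 0)

/-- The coefficient `(σ+2k)(σ+2k-1)⋯(σ+k+1) / k!`, through which alone the sum `σ = μ + ν` of the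
orders enters the `k`-th coefficient of the product `C_μ C_ν`. -/
noncomputable def cliffordProductCoeff (σ : ℝ) (k : ℕ) : ℝ :=
  (descPochhammer ℝ k).eval (σ + 2 * k) / k.factorial

theorem cliffordProductCoeff_zero (σ : ℝ) : cliffordProductCoeff σ 0 = 1 := by
  simp [cliffordProductCoeff]

theorem cliffordProductCoeff_nonneg {σ : ℝ} (hσ : -2 < σ) (k : ℕ) :
    0 ≤ cliffordProductCoeff σ k := by
  -- for `σ ≤ -1` the empty product at `k = 0` is not covered by the sign of the factors
  rcases k.eq_zero_or_pos with rfl | hk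
  · simp [cliffordProductCoeff]
  · have hk' : (1 : ℝ) ≤ k := by exact_mod_cast hk
    exact div_nonneg (descPochhammer_nonneg (by linarith)) (by positivity)

/-- The product formula, whose `k`-th coefficient depends on the two orders, for a given sum of
them, only through `1 / (Γ(μ+k+1) Γ(ν+k+1))`. -/
theorem hasSum_besselClifford_mul (μ ν : ℝ) {z : ℝ} (hz : 0 < z) :
    HasSum (fun k : ℕ => z ^ k * cliffordProductCoeff (μ + ν) k *
        ((Real.Gamma (μ + k + 1))⁻¹ * (Real.Gamma (ν + k + 1))⁻¹))
      (besselClifford μ z * besselClifford ν z) := by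
  have hf := (summable_besselClifford μ hz).norm
  have hg := (summable_besselClifford ν hz).norm
  have key : ∀ k : ℕ, (∑ ij ∈ Finset.HasAntidiagonal.antidiagonal k,
      z ^ ij.1 / ((ij.1.factorial : ℝ) * Real.Gamma ((ij.1 : ℝ) + μ + 1)) *
        (z ^ ij.2 / ((ij.2.factorial : ℝ) * Real.Gamma ((ij.2 : ℝ) + ν + 1)))) =
      z ^ k * cliffordProductCoeff (μ + ν) k *
        ((Real.Gamma (μ + k + 1))⁻¹ * (Real.Gamma (ν + k + 1))⁻¹) := by
    intro k
    rw [cliffordProductCoeff, show μ + ν + 2 * (k : ℝ) = (ν + k) + (μ + k) by ring,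
      descPochhammer_eval_add, Finset.sum_div, Finset.mul_sum, Finset.sum_mul]
    refine Finset.sum_congr rfl fun ij hij => ?_
    obtain ⟨i, j⟩ := ij
    obtain rfl : i + j = k := by simpa using hij
    have h1 := inv_Gamma_sub_nat_eq (μ + (i + j : ℕ)) j
    have h2 := inv_Gamma_sub_nat_eq (ν + (i + j : ℕ)) i
    rw [show μ + (i + j : ℕ) + 1 - j = i + μ + 1 by push_cast; ring] at h1
    rw [show ν + (i + j : ℕ) + 1 - i = j + ν + 1 by push_cast; ring] at h2
    have h3 : (((i + j).choose i : ℕ) : ℝ) * (i.factorial * j.factorial) = (i + j).factorial := by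
      have := Nat.add_choose_mul_factorial_mul_factorial i j
      rw [← mul_assoc, Nat.choose_symm_add]
      exact_mod_cast this
    have hi : (i.factorial : ℝ) ≠ 0 := by positivity
    have hj : (j.factorial : ℝ) ≠ 0 := by positivity
    have hc : (((i + j).choose i : ℕ) : ℝ) / (i + j).factorial
        = 1 / ((i.factorial : ℝ) * j.factorial) := by
      rw [← h3]
      have : (((i + j).choose i : ℕ) : ℝ) ≠ 0 := by
        exact_mod_cast (Nat.choose_pos (Nat.le_add_right i j)).ne'
      field_simp
    rw [div_mul_eq_div_mul_one_div, one_div (Real.Gamma _), h1, div_mul_eq_div_mul_one_div,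
      one_div (Real.Gamma _), h2, mul_div_right_comm, hc, pow_add]
    field_simp
  have hs := (summable_norm_sum_mul_antidiagonal_of_summable_norm hf hg).of_norm
  have ht := tsum_mul_tsum_eq_tsum_sum_antidiagonal_of_summable_norm hf hg
  simp only [key] at hs ht
  rw [besselClifford, besselClifford, ht]
  exact hs.hasSum

/-- The two mixed products combine to a series of the same shape. -/
theorem hasSum_besselClifford_mul_add_mul (μ ν : ℝ) {z : ℝ} (hz : 0 < z) :
    HasSum (fun k : ℕ => z ^ k * (cliffordProductCoeff (μ + ν + 1) k * (μ + ν + 2 * k + 2)) *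
        ((Real.Gamma (μ + (k + 1 : ℕ) + 1))⁻¹ * (Real.Gamma (ν + (k + 1 : ℕ) + 1))⁻¹))
      (besselClifford (μ + 1) z * besselClifford ν z +
        besselClifford μ z * besselClifford (ν + 1) z) := by
  refine ((hasSum_besselClifford_mul (μ + 1) ν hz).add
    (hasSum_besselClifford_mul μ (ν + 1) hz)).congr_fun fun k => ?_
  have h1 := inv_Gamma_eq_mul_inv_Gamma_add_one (ν + k + 1)
  have h2 := inv_Gamma_eq_mul_inv_Gamma_add_one (μ + k + 1)
  rw [h1, h2, show μ + 1 + ν = μ + ν + 1 by ring, show μ + (ν + 1) = μ + ν + 1 by ring,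
    show μ + 1 + k + 1 = μ + k + 1 + 1 by ring, show ν + 1 + k + 1 = ν + k + 1 + 1 by ring,
    show μ + (k + 1 : ℕ) + 1 = μ + k + 1 + 1 by push_cast; ring,
    show ν + (k + 1 : ℕ) + 1 = ν + k + 1 + 1 by push_cast; ring]
  ring

/-! ### Turán type inequalities -/

/-- `F_ν(y) = C_ν(y²) + y C_{ν+1}(y²)`, which is `Φ_ν(2y)` up to the factor `e^{-2y} 2^{-ν}`. -/
noncomputable def cliffordSum (ν y : ℝ) : ℝ :=
  besselClifford ν (y ^ 2) + y * besselClifford (ν + 1) (y ^ 2)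

theorem besselPhi_eq {x : ℝ} (hx : 0 < x) (ν : ℝ) :
    besselPhi ν x = Real.exp (-x) * 2 ^ (-ν) * cliffordSum ν (x / 2) := by
  have h2 : 0 < x / 2 := by positivity
  have h3 : x ^ (-ν) * (x / 2) ^ ν = 2 ^ (-ν) := by
    rw [Real.div_rpow hx.le two_pos.le, Real.rpow_neg hx.le, Real.rpow_neg two_pos.le]
    have := (Real.rpow_pos_of_pos hx ν).ne'
    field_simp
  rw [besselPhi, besselI_eq hx, besselI_eq hx, Real.rpow_add_one h2.ne', cliffordSum, ← h3]
  ring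

theorem cliffordSum_pos {ν y : ℝ} (hν : -1 < ν) (hy : 0 < y) : 0 < cliffordSum ν y := by
  have h1 := besselClifford_pos hν (pow_pos hy 2)
  have h2 := besselClifford_pos (show -1 < ν + 1 by linarith) (pow_pos hy 2)
  rw [cliffordSum]
  positivity

theorem besselClifford_mul_le {μ ν s z : ℝ} (hz : 0 < z) (hσ : μ + ν = 2 * s) (hs : -1 < s)
    (h : ∀ k : ℕ, (Real.Gamma (μ + k + 1))⁻¹ * (Real.Gamma (ν + k + 1))⁻¹ ≤
      (Real.Gamma (s + k + 1))⁻¹ * (Real.Gamma (s + k + 1))⁻¹) :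
    besselClifford μ z * besselClifford ν z ≤ besselClifford s z * besselClifford s z := by
  refine hasSum_le (fun k => ?_) (hasSum_besselClifford_mul μ ν hz)
    (hasSum_besselClifford_mul s s hz)
  rw [hσ, ← two_mul]
  exact mul_le_mul_of_nonneg_left (h k)
    (mul_nonneg (by positivity) (cliffordProductCoeff_nonneg (by linarith) k))

theorem besselClifford_mul_lt {μ ν s z : ℝ} (hz : 0 < z) (hσ : μ + ν = 2 * s) (hs : -1 < s)
    (h : ∀ k : ℕ, (Real.Gamma (μ + k + 1))⁻¹ * (Real.Gamma (ν + k + 1))⁻¹ <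
      (Real.Gamma (s + k + 1))⁻¹ * (Real.Gamma (s + k + 1))⁻¹) :
    besselClifford μ z * besselClifford ν z < besselClifford s z * besselClifford s z := by
  refine hasSum_lt (i := 0) (fun k => ?_) ?_ (hasSum_besselClifford_mul μ ν hz)
    (hasSum_besselClifford_mul s s hz)
  · dsimp only
    rw [hσ, ← two_mul]
    exact mul_le_mul_of_nonneg_left (h k).le
      (mul_nonneg (by positivity) (cliffordProductCoeff_nonneg (by linarith) k))
  · simpa [cliffordProductCoeff_zero] using h 0

theorem besselClifford_mul_add_mul_le {μ ν s z : ℝ} (hz : 0 < z) (hσ : μ + ν = 2 * s)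
    (hs : -1 < s)
    (h : ∀ k : ℕ, (Real.Gamma (μ + k + 1))⁻¹ * (Real.Gamma (ν + k + 1))⁻¹ ≤
      (Real.Gamma (s + k + 1))⁻¹ * (Real.Gamma (s + k + 1))⁻¹) :
    besselClifford (μ + 1) z * besselClifford ν z + besselClifford μ z * besselClifford (ν + 1) z ≤
      besselClifford (s + 1) z * besselClifford s z +
        besselClifford s z * besselClifford (s + 1) z := by
  refine hasSum_le (fun k => ?_) (hasSum_besselClifford_mul_add_mul μ ν hz)
    (hasSum_besselClifford_mul_add_mul s s hz)
  rw [hσ, ← two_mul]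
  have hk : (0 : ℝ) ≤ k := k.cast_nonneg
  exact mul_le_mul_of_nonneg_left (h (k + 1)) (mul_nonneg (by positivity)
    (mul_nonneg (cliffordProductCoeff_nonneg (by linarith) k) (by linarith)))

theorem cliffordSum_mul_eq (μ ν y : ℝ) :
    cliffordSum μ y * cliffordSum ν y =
      besselClifford μ (y ^ 2) * besselClifford ν (y ^ 2) +
      y ^ 2 * (besselClifford (μ + 1) (y ^ 2) * besselClifford (ν + 1) (y ^ 2)) +
      y * (besselClifford (μ + 1) (y ^ 2) * besselClifford ν (y ^ 2) +
        besselClifford μ (y ^ 2) * besselClifford (ν + 1) (y ^ 2)) := by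
  rw [cliffordSum, cliffordSum]
  ring

/-- Comparison of `F_μ F_ν` with `F_s²` at `s = (μ+ν)/2`, from that of the reciprocal Gamma
factors. The orders `μ`, `ν` themselves may lie below `-1`. -/
theorem cliffordSum_mul_le {μ ν s y : ℝ} (hy : 0 < y) (hσ : μ + ν = 2 * s) (hs : -1 < s)
    (h : ∀ k : ℕ, (Real.Gamma (μ + k + 1))⁻¹ * (Real.Gamma (ν + k + 1))⁻¹ ≤
      (Real.Gamma (s + k + 1))⁻¹ * (Real.Gamma (s + k + 1))⁻¹) :
    cliffordSum μ y * cliffordSum ν y ≤ cliffordSum s y * cliffordSum s y := by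
  have hz : 0 < y ^ 2 := by positivity
  have h' : ∀ k : ℕ, (Real.Gamma (μ + 1 + k + 1))⁻¹ * (Real.Gamma (ν + 1 + k + 1))⁻¹ ≤
      (Real.Gamma (s + 1 + k + 1))⁻¹ * (Real.Gamma (s + 1 + k + 1))⁻¹ := fun k => by
    have := h (k + 1)
    push_cast at this
    simpa only [add_assoc, add_comm, add_left_comm] using this
  rw [cliffordSum_mul_eq, cliffordSum_mul_eq]
  have h1 := besselClifford_mul_le hz hσ hs h
  have h2 := besselClifford_mul_le (μ := μ + 1) (ν := ν + 1) (s := s + 1) hz (by linarith)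
    (by linarith) h'
  have h3 := besselClifford_mul_add_mul_le hz hσ hs h
  gcongr

theorem cliffordSum_mul_lt {μ ν s y : ℝ} (hy : 0 < y) (hσ : μ + ν = 2 * s) (hs : -1 < s)
    (h : ∀ k : ℕ, (Real.Gamma (μ + k + 1))⁻¹ * (Real.Gamma (ν + k + 1))⁻¹ <
      (Real.Gamma (s + k + 1))⁻¹ * (Real.Gamma (s + k + 1))⁻¹) :
    cliffordSum μ y * cliffordSum ν y < cliffordSum s y * cliffordSum s y := by
  have hz : 0 < y ^ 2 := by positivity
  have h' : ∀ k : ℕ, (Real.Gamma (μ + 1 + k + 1))⁻¹ * (Real.Gamma (ν + 1 + k + 1))⁻¹ <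
      (Real.Gamma (s + 1 + k + 1))⁻¹ * (Real.Gamma (s + 1 + k + 1))⁻¹ := fun k => by
    have := h (k + 1)
    push_cast at this
    simpa only [add_assoc, add_comm, add_left_comm] using this
  rw [cliffordSum_mul_eq, cliffordSum_mul_eq]
  have h1 := besselClifford_mul_lt hz hσ hs h
  have h2 := besselClifford_mul_lt (μ := μ + 1) (ν := ν + 1) (s := s + 1) hz (by linarith)
    (by linarith) h'
  have h3 := besselClifford_mul_add_mul_le hz hσ hs fun k => (h k).le
  exact add_lt_add_of_lt_of_le (add_lt_add h1 (mul_lt_mul_of_pos_left h2 hz))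
    (mul_le_mul_of_nonneg_left h3 hy.le)

/-- The Turán inequality for `F`, valid on all of `(-1, ∞)`: here
`1 / (Γ(a) Γ(a+2)) = a / ((a+1) Γ(a+1)²)` also for `-1 < a ≤ 0`. -/
theorem cliffordSum_turan {ν y : ℝ} (hν : -1 < ν) (hy : 0 < y) :
    cliffordSum (ν - 1) y * cliffordSum (ν + 1) y < cliffordSum ν y * cliffordSum ν y := by
  refine cliffordSum_mul_lt hy (by ring) hν fun k => ?_
  have hk : (0 : ℝ) ≤ k := k.cast_nonneg
  have ha : 0 < ν + k + 1 := by linarith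
  have hG := Real.Gamma_pos_of_pos ha
  rw [show ν - 1 + k + 1 = ν + k by ring, show ν + 1 + k + 1 = ν + k + 1 + 1 by ring,
    inv_Gamma_eq_mul_inv_Gamma_add_one (ν + k), Real.Gamma_add_one ha.ne', mul_inv]
  have h0 : 0 < (Real.Gamma (ν + k + 1))⁻¹ * (Real.Gamma (ν + k + 1))⁻¹ := by positivity
  have h1 : (ν + k) * (ν + k + 1)⁻¹ < 1 := by
    rw [← div_eq_mul_inv, div_lt_one ha]
    linarith
  calc (ν + k) * (Real.Gamma (ν + k + 1))⁻¹ * ((ν + k + 1)⁻¹ * (Real.Gamma (ν + k + 1))⁻¹)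
      = (ν + k) * (ν + k + 1)⁻¹ *
          ((Real.Gamma (ν + k + 1))⁻¹ * (Real.Gamma (ν + k + 1))⁻¹) := by ring
    _ < 1 * ((Real.Gamma (ν + k + 1))⁻¹ * (Real.Gamma (ν + k + 1))⁻¹) := by gcongr
    _ = _ := one_mul _

theorem Gamma_sq_le_mul {a b c : ℝ} (ha : 0 < a) (hb : 0 < b) (hc : a + b = 2 * c) :
    Real.Gamma c * Real.Gamma c ≤ Real.Gamma a * Real.Gamma b := by
  obtain rfl : c = 1 / 2 * a + 1 / 2 * b := by linarith
  have h := Real.Gamma_mul_add_mul_le_rpow_Gamma_mul_rpow_Gamma ha hb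
    (one_half_pos (α := ℝ)) (one_half_pos (α := ℝ)) (by norm_num)
  have hA := Real.Gamma_pos_of_pos ha
  have hB := Real.Gamma_pos_of_pos hb
  rw [← Real.mul_rpow hA.le hB.le, ← Real.sqrt_eq_rpow] at h
  have h0 := (Real.Gamma_pos_of_pos (show 0 < 1 / 2 * a + 1 / 2 * b by positivity)).le
  calc _ ≤ √(Real.Gamma a * Real.Gamma b) * √(Real.Gamma a * Real.Gamma b) :=
        mul_self_le_mul_self h0 h
    _ = _ := Real.mul_self_sqrt (by positivity)

theorem cliffordSum_mul_le_midpoint {μ ν y : ℝ} (hμ : -1 < μ) (hν : -1 < ν) (hy : 0 < y) :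
    cliffordSum μ y * cliffordSum ν y ≤
      cliffordSum ((μ + ν) / 2) y * cliffordSum ((μ + ν) / 2) y := by
  refine cliffordSum_mul_le hy (by ring) (by linarith) fun k => ?_
  have hk : (0 : ℝ) ≤ k := k.cast_nonneg
  rw [← mul_inv, ← mul_inv]
  have h0 := Real.Gamma_pos_of_pos (show 0 < (μ + ν) / 2 + k + 1 by linarith)
  exact inv_anti₀ (by positivity) (Gamma_sq_le_mul (by linarith) (by linarith) (by ring))

/-! ### Concavity in the order -/

/-- A continuous midpoint-concave function on a convex set of real numbers is concave. -/
theorem concaveOn_of_midpoint {s : Set ℝ} {f : ℝ → ℝ} (hs : Convex ℝ s) (hf : ContinuousOn f s)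
    (hmid : ∀ a ∈ s, ∀ b ∈ s, f a + f b ≤ 2 * f ((a + b) / 2)) : ConcaveOn ℝ s f := by
  refine ⟨hs, fun u hu v hv a b ha hb hab => ?_⟩
  -- `g` measures the excess of `f` over its chord along the segment from `u` to `v`
  set p : ℝ → ℝ := fun t => (1 - t) * u + t * v with hp
  set g : ℝ → ℝ := fun t => f (p t) - ((1 - t) * f u + t * f v) with hg
  have hps : MapsTo p (Icc 0 1) s := fun t ht =>
    hs hu hv (sub_nonneg.2 ht.2) ht.1 (by ring)
  have hgc : ContinuousOn g (Icc 0 1) :=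
    (hf.comp (by fun_prop) hps).sub (by fun_prop)
  have hg0 : g 0 = 0 := by simp [hg, hp]
  have hg1 : g 1 = 0 := by simp [hg, hp]
  have hgm : ∀ t ∈ Icc (0 : ℝ) 1, ∀ r ∈ Icc (0 : ℝ) 1, g t + g r ≤ 2 * g ((t + r) / 2) := by
    intro t ht r hr
    have h := hmid _ (hps ht) _ (hps hr)
    have h2 : p ((t + r) / 2) = (p t + p r) / 2 := by simp only [hp]; ring
    simp only [hg, h2]
    linarith
  suffices hpos : ∀ t ∈ Icc (0 : ℝ) 1, 0 ≤ g t by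
    have h := hpos b ⟨hb, by linarith⟩
    obtain rfl : a = 1 - b := by linarith
    simp only [hg, hp] at h
    simp only [smul_eq_mul]
    linarith
  by_contra! hneg
  obtain ⟨t₁, ht₁, hlt⟩ := hneg
  obtain ⟨m, hm, hmin⟩ := isCompact_Icc.exists_isMinOn ⟨t₁, ht₁⟩ hgc
  have hgm_neg : g m < 0 := (hmin ht₁).trans_lt hlt
  -- the leftmost minimiser is interior, and midpoint concavity fails around it
  have hK : IsCompact (Icc (0 : ℝ) 1 ∩ g ⁻¹' {g m}) :=
    isCompact_Icc.of_isClosed_subset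
      (hgc.preimage_isClosed_of_isClosed isClosed_Icc isClosed_singleton) inter_subset_left
  obtain ⟨c, ⟨hc, hcm⟩, hleast⟩ := hK.exists_isLeast ⟨m, hm, rfl⟩
  have hcm : g c = g m := hcm
  have hc0 : 0 < c := lt_of_le_of_ne hc.1 fun h => by rw [← h, hg0] at hcm; linarith
  have hc1 : c < 1 := lt_of_le_of_ne hc.2 fun h => by rw [h, hg1] at hcm; linarith
  obtain ⟨d, hd, hd1, hd2⟩ : ∃ d > 0, d ≤ c ∧ d ≤ 1 - c :=
    ⟨min c (1 - c), lt_min hc0 (sub_pos.2 hc1), min_le_left _ _, min_le_right _ _⟩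
  have hl : c - d ∈ Icc (0 : ℝ) 1 := ⟨by linarith, by linarith⟩
  have hr : c + d ∈ Icc (0 : ℝ) 1 := ⟨by linarith, by linarith⟩
  have h1 : g m < g (c - d) := lt_of_le_of_ne (hmin hl) fun h => by
    have := hleast ⟨hl, h.symm⟩
    linarith
  have h2 : g m ≤ g (c + d) := hmin hr
  have h3 := hgm _ hl _ hr
  rw [show (c - d + (c + d)) / 2 = c by ring, hcm] at h3
  linarith

theorem exists_pos_forall_le_Gamma : ∃ c : ℝ, 0 < c ∧ ∀ t : ℝ, 0 < t → c ≤ Real.Gamma t := by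
  obtain ⟨a, ha, hmin⟩ := Real.exists_isMinOn_Gamma_Ioi
  exact ⟨_, Real.Gamma_pos_of_pos (zero_lt_one.trans ha.1), fun t ht => isMinOn_iff.1 hmin t ht⟩

theorem continuousAt_Gamma_of_pos {t : ℝ} (ht : 0 < t) : ContinuousAt Real.Gamma t :=
  (Real.differentiableAt_Gamma fun m h => by
    have hm : (0 : ℝ) ≤ m := m.cast_nonneg
    linarith).continuousAt

theorem continuousOn_besselClifford {z : ℝ} (hz : 0 < z) :
    ContinuousOn (fun ν => besselClifford ν z) (Ioi (-1)) := by
  obtain ⟨c, hc0, hc⟩ := exists_pos_forall_le_Gamma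
  have harg : ∀ (n : ℕ) (ν : ℝ), -1 < ν → 0 < (n : ℝ) + ν + 1 := fun n ν hν => by
    have hn : (0 : ℝ) ≤ n := n.cast_nonneg
    linarith
  have hcont : ∀ n : ℕ, ContinuousOn
      (fun ν : ℝ => z ^ n / ((n.factorial : ℝ) * Real.Gamma ((n : ℝ) + ν + 1))) (Ioi (-1)) := by
    intro n ν hν
    have hG : ContinuousAt (fun ν : ℝ => Real.Gamma ((n : ℝ) + ν + 1)) ν :=
      ContinuousAt.comp (g := Real.Gamma) (f := fun ν : ℝ => (n : ℝ) + ν + 1)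
        (continuousAt_Gamma_of_pos (harg n ν hν)) (by fun_prop)
    have h0 := Real.Gamma_pos_of_pos (harg n ν hν)
    have hne : (n.factorial : ℝ) * Real.Gamma ((n : ℝ) + ν + 1) ≠ 0 := by positivity
    exact (continuousAt_const.div (continuousAt_const.mul hG) hne).continuousWithinAt
  have hsum : Summable fun n : ℕ => z ^ n / (n.factorial : ℝ) * c⁻¹ :=
    (Real.summable_pow_div_factorial z).mul_right _
  refine continuousOn_tsum hcont hsum fun n ν hν => ?_
  have h0 := Real.Gamma_pos_of_pos (harg n ν hν)
  have h1 := hc _ (harg n ν hν)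
  rw [Real.norm_of_nonneg (by positivity), ← div_div, div_eq_mul_inv (z ^ n / (n.factorial : ℝ))]
  exact mul_le_mul_of_nonneg_left (inv_anti₀ hc0 h1) (by positivity)

theorem continuousOn_cliffordSum {y : ℝ} (hy : 0 < y) :
    ContinuousOn (fun ν => cliffordSum ν y) (Ioi (-1)) := by
  have hc := continuousOn_besselClifford (pow_pos hy 2)
  refine hc.add (continuousOn_const.mul (hc.comp (f := fun ν : ℝ => ν + 1) (by fun_prop) ?_))
  intro ν hν
  have : -1 < ν := hν
  exact show -1 < ν + 1 by linarith

theorem concaveOn_log_cliffordSum {y : ℝ} (hy : 0 < y) :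
    ConcaveOn ℝ (Ioi (-1)) fun ν => Real.log (cliffordSum ν y) := by
  refine concaveOn_of_midpoint (convex_Ioi _)
    ((continuousOn_cliffordSum hy).log fun ν hν => (cliffordSum_pos hν hy).ne') ?_
  intro a ha b hb
  have ha' : -1 < a := ha
  have hb' : -1 < b := hb
  have hpa := cliffordSum_pos ha' hy
  have hpb := cliffordSum_pos hb' hy
  have hpm := cliffordSum_pos (show -1 < (a + b) / 2 by linarith) hy
  rw [← Real.log_mul hpa.ne' hpb.ne', two_mul, ← Real.log_mul hpm.ne' hpm.ne']
  exact Real.log_le_log (by positivity) (cliffordSum_mul_le_midpoint ha' hb' hy)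

theorem besselPhi_pos {ν x : ℝ} (hν : -1 < ν) (hx : 0 < x) : 0 < besselPhi ν x := by
  have := cliffordSum_pos hν (half_pos hx)
  rw [besselPhi_eq hx]
  positivity

theorem logConcaveOn_besselPhi {x : ℝ} (hx : 0 < x) :
    LogConcaveOn (Ioi (-1)) fun ν => besselPhi ν x := by
  refine ⟨fun ν hν => besselPhi_pos hν hx, ?_⟩
  have hlin : ConcaveOn ℝ (Ioi (-1)) fun ν : ℝ => -x + -ν * Real.log 2 :=
    ⟨convex_Ioi _, fun u _ v _ a b _ _ hab => by
      simp only [smul_eq_mul]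
      obtain rfl : a = 1 - b := by linarith
      linarith⟩
  refine (hlin.add (concaveOn_log_cliffordSum (half_pos hx))).congr fun ν hν => ?_
  have := cliffordSum_pos hν (half_pos hx)
  simp only [Pi.add_apply]
  rw [besselPhi_eq hx, Real.log_mul (by positivity) this.ne', Real.log_mul (by positivity)
    (by positivity), Real.log_exp, Real.log_rpow two_pos]

theorem besselPhi_turan {ν x : ℝ} (hν : -1 < ν) (hx : 0 < x) :
    besselPhi (ν - 1) x * besselPhi (ν + 1) x < besselPhi ν x ^ 2 := by
  have h := cliffordSum_turan hν (half_pos hx)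
  have h2 : (2 : ℝ) ^ (-(ν - 1)) * 2 ^ (-(ν + 1)) = 2 ^ (-ν) * 2 ^ (-ν) := by
    rw [← Real.rpow_add two_pos, ← Real.rpow_add two_pos]
    congr 1
    ring
  have hc : 0 < Real.exp (-x) ^ 2 * ((2 : ℝ) ^ (-ν) * 2 ^ (-ν)) := by positivity
  calc besselPhi (ν - 1) x * besselPhi (ν + 1) x
      = Real.exp (-x) ^ 2 * ((2 : ℝ) ^ (-(ν - 1)) * 2 ^ (-(ν + 1))) *
          (cliffordSum (ν - 1) (x / 2) * cliffordSum (ν + 1) (x / 2)) := by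
        rw [besselPhi_eq hx, besselPhi_eq hx]
        ring
    _ < Real.exp (-x) ^ 2 * ((2 : ℝ) ^ (-ν) * 2 ^ (-ν)) *
          (cliffordSum ν (x / 2) * cliffordSum ν (x / 2)) := by
        rw [h2]
        exact mul_lt_mul_of_pos_left h hc
    _ = besselPhi ν x ^ 2 := by
        rw [besselPhi_eq hx]
        ring

open MeasureTheory ProbabilityTheory

/-! ### Moment generating functions of nonpositive variables -/

theorem completelyMonotonicOnIoi_of_eq_mgf {Ω : Type*} [MeasurableSpace Ω] {μ : Measure Ω}
    {X : Ω → ℝ} {a : ℝ} {f : ℝ → ℝ} (hX : ∀ᵐ ω ∂μ, X ω ≤ 0)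
    (hint : Ioi a ⊆ integrableExpSet X μ) (hf : ∀ t ∈ Ioi a, f t = mgf X μ t) :
    CompletelyMonotonicOnIoi a f := by
  have hsub : Ioi a ⊆ interior (integrableExpSet X μ) := interior_maximal hint isOpen_Ioi
  refine ⟨?_, fun m t ht => ?_⟩
  · refine ContDiffOn.congr (fun t ht => ?_) hf
    exact (analyticAt_mgf (hsub ht)).contDiffAt.contDiffWithinAt
  · have heq : f =ᶠ[𝓝 t] mgf X μ := by
      filter_upwards [isOpen_Ioi.mem_nhds ht] with s hs using hf s hs
    rw [heq.iteratedDeriv_eq, iteratedDeriv_mgf (hsub ht), ← integral_const_mul]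
    refine integral_nonneg_of_ae ?_
    filter_upwards [hX] with ω hω
    rw [Pi.zero_apply, ← mul_assoc, ← mul_pow, neg_one_mul]
    exact mul_nonneg (pow_nonneg (neg_nonneg.2 hω) m) (Real.exp_pos _).le

theorem convexOn_cgf {Ω : Type*} [MeasurableSpace Ω] {μ : Measure Ω} {X : Ω → ℝ} :
    ConvexOn ℝ (interior (integrableExpSet X μ)) (cgf X μ) := by
  refine convexOn_of_deriv2_nonneg' convex_integrableExpSet.interior
    (fun t ht => (analyticAt_cgf ht).differentiableAt.differentiableWithinAt)
    (fun t ht => (analyticAt_cgf ht).deriv.differentiableAt.differentiableWithinAt)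
    fun t ht => ?_
  rw [← iteratedDeriv_eq_iterate, iteratedDeriv_two_cgf_eq_integral ht]
  exact div_nonneg (integral_nonneg fun ω => by positivity) mgf_nonneg

/-! ### The representing measure -/

theorem lintegral_rpow_mul_one_sub_rpow {a b : ℝ} (ha : 0 < a) (hb : 0 < b) :
    ∫⁻ s in Ioo (0 : ℝ) 1, ENNReal.ofReal (s ^ (a - 1) * (1 - s) ^ (b - 1)) =
      ENNReal.ofReal (beta a b) := by
  have h := lintegral_betaPDF_eq_one ha hb
  have hB := beta_pos ha hb
  have hB' : ENNReal.ofReal (beta a b) ≠ 0 := by simpa using hB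
  simp only [lintegral_betaPDF, mul_assoc, one_div, ENNReal.ofReal_mul (inv_nonneg.2 hB.le)] at h
  rw [lintegral_const_mul _ (by fun_prop), ENNReal.ofReal_inv_of_pos hB] at h
  rw [← mul_one (ENNReal.ofReal (beta a b)), ← h,
    ENNReal.mul_inv_cancel_left hB' ENNReal.ofReal_ne_top]

/-- The measure on `(0, 1)` with density `∑ zⁿ sⁿ⁺ᵖ⁻¹ (1-s)^(-1/2) / (n! Γ(n+p))`, written as a sum
of measures. By the Beta integral its integral of `(1-s)^t` is `Γ(t+1/2) C_{t+p-1/2}(z)`. -/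
noncomputable def cliffordMeasure (p z : ℝ) : Measure ℝ :=
  Measure.sum fun n : ℕ => (volume.restrict (Ioo 0 1)).withDensity fun s =>
    ENNReal.ofReal (z ^ n / (n.factorial * Real.Gamma (n + p)) *
      (s ^ ((n : ℝ) + p - 1) * (1 - s) ^ (-(1 / 2) : ℝ)))

theorem ae_cliffordMeasure_mem_Ioo (p z : ℝ) : ∀ᵐ s ∂cliffordMeasure p z, s ∈ Ioo (0 : ℝ) 1 := by
  rw [cliffordMeasure, Measure.ae_sum_iff]
  exact fun n => withDensity_absolutelyContinuous _ _ (ae_restrict_mem measurableSet_Ioo)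

theorem lintegral_cliffordMeasure {p z t : ℝ} (hp : 0 < p) (hz : 0 < z) (ht : -(1 / 2) < t) :
    ∫⁻ s, ENNReal.ofReal (Real.exp (t * Real.log (1 - s))) ∂cliffordMeasure p z =
      ENNReal.ofReal (Real.Gamma (t + 1 / 2) * besselClifford (t + p - 1 / 2) z) := by
  have hΓ := Real.Gamma_pos_of_pos (show 0 < t + 1 / 2 by linarith)
  have hterm : ∀ n : ℕ, ∫⁻ s, ENNReal.ofReal (Real.exp (t * Real.log (1 - s)))
      ∂(volume.restrict (Ioo (0 : ℝ) 1)).withDensity (fun s =>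
        ENNReal.ofReal (z ^ n / (n.factorial * Real.Gamma (n + p)) *
          (s ^ ((n : ℝ) + p - 1) * (1 - s) ^ (-(1 / 2) : ℝ)))) =
      ENNReal.ofReal (Real.Gamma (t + 1 / 2) *
        (z ^ n / (n.factorial * Real.Gamma (n + (t + p - 1 / 2) + 1)))) := by
    intro n
    have hnp : 0 < (n : ℝ) + p := by positivity
    have hΓn := Real.Gamma_pos_of_pos hnp
    have hc : 0 ≤ z ^ n / (n.factorial * Real.Gamma (n + p)) := by positivity
    rw [lintegral_withDensity_eq_lintegral_mul _ (by fun_prop) (by fun_prop)]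
    have hcongr : ∀ s ∈ Ioo (0 : ℝ) 1,
        ((fun s => ENNReal.ofReal (z ^ n / (n.factorial * Real.Gamma (n + p)) *
          (s ^ ((n : ℝ) + p - 1) * (1 - s) ^ (-(1 / 2) : ℝ)))) *
          fun s => ENNReal.ofReal (Real.exp (t * Real.log (1 - s)))) s =
        ENNReal.ofReal (z ^ n / (n.factorial * Real.Gamma (n + p))) *
          ENNReal.ofReal (s ^ ((n : ℝ) + p - 1) * (1 - s) ^ (t + 1 / 2 - 1)) := by
      intro s hs
      have h1s : 0 < 1 - s := sub_pos.2 hs.2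
      rw [Pi.mul_apply, ← ENNReal.ofReal_mul' (Real.exp_pos _).le, ← ENNReal.ofReal_mul hc,
        mul_comm t, ← Real.rpow_def_of_pos h1s, mul_assoc, mul_assoc, ← Real.rpow_add h1s]
      congr 4
      ring
    rw [setLIntegral_congr_fun measurableSet_Ioo hcongr, lintegral_const_mul _ (by fun_prop),
      lintegral_rpow_mul_one_sub_rpow hnp (by linarith), ← ENNReal.ofReal_mul hc, beta,
      show (n : ℝ) + p + (t + 1 / 2) = n + (t + p - 1 / 2) + 1 by ring]
    congr 1
    field_simp
  rw [cliffordMeasure, lintegral_sum_measure, tsum_congr hterm, besselClifford, ← tsum_mul_left]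
  refine (ENNReal.ofReal_tsum_of_nonneg (fun n => ?_)
    ((summable_besselClifford (t + p - 1 / 2) hz).mul_left _)).symm
  have hn : (0 : ℝ) ≤ n := n.cast_nonneg
  have := Real.Gamma_pos_of_pos (show 0 < (n : ℝ) + (t + p - 1 / 2) + 1 by linarith)
  positivity

theorem besselPsi_eq {x : ℝ} (hx : 0 < x) (ν : ℝ) :
    besselPsi ν x =
      √Real.pi * Real.exp (-x) * (Real.Gamma (ν + 1 / 2) * cliffordSum ν (x / 2)) := by
  have h2 : (2 : ℝ) ^ ν * 2 ^ (-ν) = 1 := by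
    rw [← Real.rpow_add two_pos, add_neg_cancel, Real.rpow_zero]
  rw [besselPsi, besselPhi_eq hx]
  linear_combination (√Real.pi * Real.exp (-x) * (Real.Gamma (ν + 1 / 2) *
    cliffordSum ν (x / 2))) * h2

theorem besselPsi_pos {ν x : ℝ} (hν : -1 / 2 < ν) (hx : 0 < x) : 0 < besselPsi ν x := by
  have h1 := cliffordSum_pos (show -1 < ν by linarith) (half_pos hx)
  have h2 := Real.Gamma_pos_of_pos (show 0 < ν + 1 / 2 by linarith)
  rw [besselPsi_eq hx]
  positivity

/-- The measure on `(0, 1)` for which `Ψ_ν(x) = ∫ (1-s)^ν`. -/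
noncomputable def besselPsiMeasure (x : ℝ) : Measure ℝ :=
  ENNReal.ofReal (√Real.pi * Real.exp (-x)) • (cliffordMeasure (1 / 2) ((x / 2) ^ 2) +
    ENNReal.ofReal (x / 2) • cliffordMeasure (3 / 2) ((x / 2) ^ 2))

theorem ae_besselPsiMeasure_log_nonpos (x : ℝ) :
    ∀ᵐ s ∂besselPsiMeasure x, Real.log (1 - s) ≤ 0 := by
  have h : ∀ᵐ s ∂besselPsiMeasure x, s ∈ Ioo (0 : ℝ) 1 :=
    Measure.ae_smul_measure (ae_add_measure_iff.2 ⟨ae_cliffordMeasure_mem_Ioo _ _,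
      Measure.ae_smul_measure (ae_cliffordMeasure_mem_Ioo _ _) _⟩) _
  filter_upwards [h] with s hs
  exact Real.log_nonpos (sub_nonneg.2 hs.2.le) (by linarith [hs.1])

theorem lintegral_besselPsiMeasure {x t : ℝ} (hx : 0 < x) (ht : -1 / 2 < t) :
    ∫⁻ s, ENNReal.ofReal (Real.exp (t * Real.log (1 - s))) ∂besselPsiMeasure x =
      ENNReal.ofReal (besselPsi t x) := by
  have hz : 0 < (x / 2) ^ 2 := by positivity
  have hΓ := Real.Gamma_pos_of_pos (show 0 < t + 1 / 2 by linarith)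
  have h0 := besselClifford_pos (show -1 < t by linarith) hz
  have h1 := besselClifford_pos (show -1 < t + 1 by linarith) hz
  rw [besselPsiMeasure, lintegral_smul_measure, lintegral_add_measure, lintegral_smul_measure,
    lintegral_cliffordMeasure (by norm_num) hz (by linarith),
    lintegral_cliffordMeasure (by norm_num) hz (by linarith),
    show t + 1 / 2 - 1 / 2 = t by ring, show t + 3 / 2 - 1 / 2 = t + 1 by ring, smul_eq_mul,
    smul_eq_mul, ← ENNReal.ofReal_mul (by positivity), ← ENNReal.ofReal_add (by positivity)
    (by positivity), ← ENNReal.ofReal_mul (by positivity), besselPsi_eq hx, cliffordSum]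
  congr 1
  ring

theorem integrable_exp_besselPsiMeasure {x t : ℝ} (hx : 0 < x) (ht : -1 / 2 < t) :
    Integrable (fun s => Real.exp (t * Real.log (1 - s))) (besselPsiMeasure x) := by
  refine ⟨Measurable.aestronglyMeasurable (by fun_prop), ?_⟩
  rw [hasFiniteIntegral_iff_ofReal (ae_of_all _ fun s => (Real.exp_pos _).le),
    lintegral_besselPsiMeasure hx ht]
  exact ENNReal.ofReal_lt_top

/-- `Ψ_ν(x)` is a moment generating function in `ν`. -/
theorem besselPsi_eq_mgf {x t : ℝ} (hx : 0 < x) (ht : -1 / 2 < t) :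
    besselPsi t x = mgf (fun s => Real.log (1 - s)) (besselPsiMeasure x) t := by
  rw [mgf, integral_eq_lintegral_of_nonneg_ae (ae_of_all _ fun s => (Real.exp_pos _).le)
    (integrable_exp_besselPsiMeasure hx ht).1, lintegral_besselPsiMeasure hx ht,
    ENNReal.toReal_ofReal (besselPsi_pos ht hx).le]

theorem completelyMonotonicOnIoi_besselPsi {x : ℝ} (hx : 0 < x) :
    CompletelyMonotonicOnIoi (-1 / 2) fun ν => besselPsi ν x :=
  completelyMonotonicOnIoi_of_eq_mgf (ae_besselPsiMeasure_log_nonpos x)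
    (fun _ ht => integrable_exp_besselPsiMeasure hx ht) fun _ ht => besselPsi_eq_mgf hx ht

theorem logConvexOn_besselPsi {x : ℝ} (hx : 0 < x) :
    LogConvexOn (Ioi (-1 / 2)) fun ν => besselPsi ν x := by
  refine ⟨fun ν hν => besselPsi_pos hν hx, ?_⟩
  have hsub : Ioi (-1 / 2 : ℝ) ⊆
      interior (integrableExpSet (fun s => Real.log (1 - s)) (besselPsiMeasure x)) :=
    interior_maximal (fun _ ht => integrable_exp_besselPsiMeasure hx ht) isOpen_Ioi
  refine (convexOn_cgf.subset hsub (convex_Ioi _)).congr fun ν hν => ?_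
  simp only [cgf, besselPsi_eq_mgf hx hν]

/-! ### The reversed Turán inequality -/

theorem besselPsi_sq_le {ν x : ℝ} (hν : 1 / 2 < ν) (hx : 0 < x) :
    besselPsi ν x ^ 2 ≤ besselPsi (ν - 1) x * besselPsi (ν + 1) x := by
  have h0 := besselPsi_pos (show -1 / 2 < ν by linarith) hx
  have h1 := besselPsi_pos (show -1 / 2 < ν - 1 by linarith) hx
  have h2 := besselPsi_pos (show -1 / 2 < ν + 1 by linarith) hx
  have h := (logConvexOn_besselPsi hx).2.2 (show ν - 1 ∈ Ioi (-1 / 2 : ℝ) from by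
    simp only [mem_Ioi]; linarith) (show ν + 1 ∈ Ioi (-1 / 2 : ℝ) from by
    simp only [mem_Ioi]; linarith) (one_half_pos (α := ℝ)).le (one_half_pos (α := ℝ)).le
    (by norm_num)
  simp only [smul_eq_mul] at h
  rw [show 1 / 2 * (ν - 1) + 1 / 2 * (ν + 1) = ν by ring] at h
  rw [← Real.log_le_log_iff (by positivity) (by positivity), Real.log_pow,
    Real.log_mul h1.ne' h2.ne']
  push_cast
  linarith

/-- Log-convexity of `Ψ` becomes a lower bound for `Φ_{ν-1} Φ_{ν+1}`, because
`Γ(ν-1/2) Γ(ν+3/2) = (ν+1/2)/(ν-1/2) Γ(ν+1/2)²`. -/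
theorem besselPhi_turan_le {ν x : ℝ} (hν : 1 / 2 < ν) (hx : 0 < x) :
    besselPhi ν x ^ 2 - besselPhi (ν - 1) x * besselPhi (ν + 1) x ≤
      1 / (ν + 1 / 2) * besselPhi ν x ^ 2 := by
  have h := besselPsi_sq_le hν hx
  have hm : 0 < ν - 1 / 2 := by linarith
  have hp : 0 < ν + 1 / 2 := by linarith
  have hΓ := Real.Gamma_pos_of_pos hm
  have h2 := Real.rpow_pos_of_pos (two_pos (α := ℝ)) (ν - 1)
  have hpi := Real.sqrt_pos.2 Real.pi_pos
  have e0 : besselPsi ν x = √Real.pi * (2 ^ (ν - 1) * 2) *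
      ((ν - 1 / 2) * Real.Gamma (ν - 1 / 2)) * besselPhi ν x := by
    rw [besselPsi, ← Real.Gamma_add_one hm.ne', ← Real.rpow_add_one two_ne_zero]
    ring_nf
  have e1 : besselPsi (ν - 1) x = √Real.pi * 2 ^ (ν - 1) *
      Real.Gamma (ν - 1 / 2) * besselPhi (ν - 1) x := by
    rw [besselPsi]
    ring_nf
  have e2 : besselPsi (ν + 1) x = √Real.pi * (2 ^ (ν - 1) * 2 * 2) *
      ((ν + 1 / 2) * ((ν - 1 / 2) * Real.Gamma (ν - 1 / 2))) * besselPhi (ν + 1) x := by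
    rw [besselPsi, ← Real.Gamma_add_one hm.ne', show ν - 1 / 2 + 1 = ν + 1 / 2 by ring,
      ← Real.Gamma_add_one hp.ne', ← Real.rpow_add_one two_ne_zero,
      ← Real.rpow_add_one two_ne_zero]
    ring_nf
  have hc : 0 < (√Real.pi * (2 ^ (ν - 1) * 2) * Real.Gamma (ν - 1 / 2)) ^ 2 * (ν - 1 / 2) := by
    positivity
  have hmain : (ν - 1 / 2) * besselPhi ν x ^ 2 ≤
      (ν + 1 / 2) * (besselPhi (ν - 1) x * besselPhi (ν + 1) x) := by
    refine le_of_mul_le_mul_left ?_ hc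
    rw [e0, e1, e2] at h
    linear_combination h
  rw [one_div_mul_eq_div, le_div_iff₀ hp]
  linear_combination hmain

theorem theorem2 :
    (∀ x : ℝ, 0 < x → LogConcaveOn (Set.Ioi (-1)) (fun ν => besselPhi ν x)) ∧
    (∀ x : ℝ, 0 < x → CompletelyMonotonicOnIoi (-1 / 2) (fun ν => besselPsi ν x)) ∧
    (∀ x : ℝ, 0 < x → LogConvexOn (Set.Ioi (-1 / 2)) (fun ν => besselPsi ν x)) ∧
    (∀ ν x : ℝ, 1 / 2 < ν → 0 < x →
      0 < besselPhi ν x ^ 2 - besselPhi (ν - 1) x * besselPhi (ν + 1) x ∧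
      besselPhi ν x ^ 2 - besselPhi (ν - 1) x * besselPhi (ν + 1) x
        ≤ 1 / (ν + 1 / 2) * besselPhi ν x ^ 2) ∧
    (∀ ν x : ℝ, -1 < ν → 0 < x →
      0 < besselPhi ν x ^ 2 - besselPhi (ν - 1) x * besselPhi (ν + 1) x) := by
  refine ⟨fun _ hx => logConcaveOn_besselPhi hx, fun _ hx => completelyMonotonicOnIoi_besselPsi hx,
    fun _ hx => logConvexOn_besselPsi hx, fun ν x hν hx => ⟨?_, besselPhi_turan_le hν hx⟩,
    fun ν x hν hx => sub_pos.2 (besselPhi_turan hν hx)⟩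
  exact sub_pos.2 (besselPhi_turan (by linarith) hx)
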